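/- Let $(X,g)$ be an admissible Riemannian polyhedron of dimension $m$: a connected space $X$ with a homeomorphism $\theta:|K|\to X$, where $K$ is a locally finite simplicial complex affinely embedded in a Euclidean space, such that every simplex of $K$ is a face of an $m$-simplex, every connected open subset of $X$ stays connected after removal of the $(m-2)$-skeleton, and every $m$-simplex carries a Riemannian metric which, in affine coordinates, is continuous (and positive definite) up to the boundary. Let $N$ be a Hermitian manifold without boundary, that is, a complex manifold with a smooth Riemannian metric invariant under the complex structure. "Almost everywhere" on $X$ means outside a set which meets every open $m$-simplex in a set of Lebesgue measure zero. On open $m$-simplexes, $\nabla$ and $\langle\cdot,\cdot\rangle$ denote the weak gradient and the inner product of $g$. Let $d_X$ be the intrinsic distance of $(X,g)$ and $\mu_g$ its Riemannian volume. For a complex manifold $M$ with a Riemannian metric and Riemannian distance $d_M$, a continuous map $\varphi:O\to M$ on an open set $O\subseteq X$ is of class $W^{1,2}_{loc}(O,M)$ if, for every domain $U$ with compact closure contained in $O$, $$\sup_{f\in C_c(U,[0,1])}\ \limsup_{\varepsilon\to0^+}\int_U f(x)\int_{\{x'\in U:\ d_X(x,x')<\varepsilon\}}\frac{d_M(\varphi(x),\varphi(x'))^2}{\varepsilon^{m+2}}\,d\mu_g(x')\,d\mu_g(x)<\infty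 .$$ A continuous map $\varphi:O\to M$ of class $W^{1,2}_{loc}(O,M)$ is called pseudo-horizontally weakly conformal if for all holomorphic functions $v=v_1+iv_2:V\to\mathbf C$ and $w=w_1+iw_2:W\to\mathbf C$ on open sets $V,W\subseteq M$, almost everywhere in $\varphi^{-1}(V\cap W)$, $$\langle\nabla(w_1\circ\varphi),\nabla(v_1\circ\varphi)\rangle-\langle\nabla(w_2\circ\varphi),\nabla(v_2\circ\varphi)\rangle=0,$$ $$\langle\nabla(w_2\circ\varphi),\nabla(v_1\circ\varphi)\rangle+\langle\nabla(w_1\circ\varphi),\nabla(v_2\circ\varphi)\rangle=0,$$ where the weak gradients are part of the requirement: they exist on each open $m$-simplex (within $\varphi^{-1}(V\cap W)$). Proposition 3.5. Let $\varphi:X\to N$ be a continuous map of class $W^{1,2}_{loc}(X,N)$. Then $\varphi$ is pseudo-horizontally weakly conformal if and only if, for every open set $V\subseteq N$ and every holomorphic function $\psi:V\to\mathbf C$, the map $\psi\circ\varphi:\varphi^{-1}(V)\to\mathbf C$ (with the Euclidean metric on $\mathbf C$) is pseudo-horizontally weakly conformal. -/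

import Mathlib

open Set Filter Topology MeasureTheory Manifold Bundle
open scoped ENNReal NNReal ContDiff Matrix

noncomputable section

/-! ### Admissible Riemannian polyhedra -/

/-- The open standard simplex of `ℝ^m`. -/
def openStdSimplex (m : ℕ) : Set (Fin m → ℝ) :=
  {x | (∀ i, 0 < x i) ∧ ∑ i, x i < 1}

/-- The closed standard simplex of `ℝ^m`. -/
def closedStdSimplex (m : ℕ) : Set (Fin m → ℝ) :=
  {x | (∀ i, 0 ≤ x i) ∧ ∑ i, x i ≤ 1}

/-- An admissible Riemannian polyhedron structure of dimension `m` on the topological space `X`: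
a triangulation `θ : |K| → X` of the connected space `X` by a locally finite simplicial complex `K`,
affinely embedded in a Euclidean space `ℝ^d`, which is dimensionally homogeneous of dimension `m`
and `(m-1)`-chainable, together with a Riemannian metric `g` on every `m`-simplex, given in
Euclidean coordinates and continuous up to the boundary of the simplex. No compatibility between
the metrics of different `m`-simplices along common faces is required. By compactness of the
simplex, continuity and positive definiteness of `g` contain the ellipticity condition
`Λ⁻² |ξ|² ≤ g(ξ, ξ) ≤ Λ² |ξ|²` on each simplex. -/
structure AdmissibleRiemannianPolyhedron (X : Type*) [TopologicalSpace X] (m : ℕ) where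
  /-- the dimension of the ambient Euclidean space -/
  d : ℕ
  /-- the simplicial complex -/
  K : Geometry.SimplicialComplex ℝ (EuclideanSpace ℝ (Fin d))
  locallyFinite : ∀ p ∈ K.space, ∃ W ∈ 𝓝 p,
    {s | s ∈ K.faces ∧ (convexHull ℝ (s : Set (EuclideanSpace ℝ (Fin d))) ∩ W).Nonempty}.Finite
  /-- the triangulation -/
  θ : K.space ≃ₜ X
  connected : ConnectedSpace X
  /-- dimensional homogeneity -/
  homogeneous : ∀ s ∈ K.faces, ∃ t ∈ K.faces, s ⊆ t ∧ t.card = m + 1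
  /-- removing the `(m-2)`-skeleton does not disconnect connected open sets -/
  chainable : ∀ U : Set X, IsOpen U → IsConnected U →
    IsConnected {p | p ∈ U ∧ ∀ s ∈ K.faces, s.card < m →
      ((θ.symm p : K.space) : EuclideanSpace ℝ (Fin d)) ∉
        convexHull ℝ (s : Set (EuclideanSpace ℝ (Fin d)))}
  /-- an enumeration of the vertices of every `m`-simplex, which fixes Euclidean (affine)
  coordinates on it -/
  vert : {s : Finset (EuclideanSpace ℝ (Fin d)) // s ∈ K.faces ∧ s.card = m + 1} →
    Fin (m + 1) → EuclideanSpace ℝ (Fin d)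
  range_vert : ∀ s, range (vert s) = (s.1 : Set (EuclideanSpace ℝ (Fin d)))
  /-- the components `g_ij` of the metric on an `m`-simplex in these coordinates -/
  g : {s : Finset (EuclideanSpace ℝ (Fin d)) // s ∈ K.faces ∧ s.card = m + 1} →
    (Fin m → ℝ) → Matrix (Fin m) (Fin m) ℝ
  g_continuous : ∀ s, ContinuousOn (g s) (closedStdSimplex m)
  g_posDef : ∀ s, ∀ x ∈ closedStdSimplex m, (g s x).PosDef

namespace AdmissibleRiemannianPolyhedron

variable {X : Type*} [TopologicalSpace X] {m : ℕ} (P : AdmissibleRiemannianPolyhedron X m)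

/-- The ambient Euclidean space of the complex. -/
abbrev Amb : Type := EuclideanSpace ℝ (Fin P.d)

/-- The maximal simplexes, i.e. the `m`-simplexes of the complex. -/
abbrev Top : Type := {s : Finset P.Amb // s ∈ P.K.faces ∧ s.card = m + 1}

/-- The position in the Euclidean space of a point of `X`. -/
def pos (p : X) : P.Amb := (P.θ.symm p : P.K.space)

/-- The affine parametrization of an `m`-simplex of `K` by the standard simplex of `ℝ^m`. -/
def affineMap (s : P.Top) (x : Fin m → ℝ) : P.Amb :=
  P.vert s 0 + ∑ i : Fin m, x i • (P.vert s i.succ - P.vert s 0)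

theorem vert_zero_mem (s : P.Top) : P.vert s 0 ∈ P.K.space := by
  refine P.K.subset_space s.2.1 ?_
  rw [← P.range_vert s]
  exact mem_range_self 0

open Classical in
/-- The parametrization of an `m`-simplex of `X` by the standard simplex of `ℝ^m` (only its
restriction to the closed standard simplex is meaningful). -/
def param (s : P.Top) (x : Fin m → ℝ) : X :=
  if h : P.affineMap s x ∈ P.K.space then P.θ ⟨P.affineMap s x, h⟩
  else P.θ ⟨P.vert s 0, P.vert_zero_mem s⟩

/-- The open `m`-simplex `Δ°` as a subset of `X`. -/
def openSimplex (s : P.Top) : Set X := P.param s '' openStdSimplex m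

/-- The Euclidean coordinates on the open `m`-simplex `Δ°`. -/
def coords (s : P.Top) (p : X) : Fin m → ℝ :=
  Function.invFunOn (P.param s) (openStdSimplex m) p

/-- The integral over `X` of a function with values in `[0, ∞]` with respect to the Riemannian
volume `μ_g`, which is `√(det g) dx` on every open `m`-simplex. -/
def volIntegral (F : X → ℝ≥0∞) : ℝ≥0∞ :=
  ∑' s : P.Top, ∫⁻ x in openStdSimplex m,
    F (P.param s x) * ENNReal.ofReal (√((P.g s x).det))

/-- Null sets: the sets meeting every maximal simplex in a set of Lebesgue measure zero. -/
def IsNull (Z : Set X) : Prop :=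
  ∀ s : P.Top, volume {x | x ∈ openStdSimplex m ∧ P.param s x ∈ Z} = 0

/-- The `(m-1)`-skeleton, i.e. the complement of the union of the open `m`-simplexes. As the metric is continuous on every
`m`-simplex, all points of open `m`-simplexes are Lebesgue points of the metric. -/
def skeleton : Set X := {p | ∀ s : P.Top, p ∉ P.openSimplex s}

/-- Lipschitz continuous paths, parametrized by `[0, 1]`. -/
def IsLipPath (γ : ℝ → X) : Prop :=
  ∃ C : ℝ≥0, LipschitzOnWith C (fun t => P.pos (γ t)) (Icc 0 1)

/-- A path is transversal to `Z` if it spends time zero in `Z`. -/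
def IsTransversalPath (γ : ℝ → X) (Z : Set X) : Prop :=
  volume {t | t ∈ Icc (0 : ℝ) 1 ∧ γ t ∈ Z} = 0

/-- The length of a path with respect to the metric `g`, measured in the open `m`-simplexes. -/
def pathLength (γ : ℝ → X) : ℝ≥0∞ :=
  ∑' s : P.Top, ∫⁻ t in {t | t ∈ Icc (0 : ℝ) 1 ∧ γ t ∈ P.openSimplex s},
    ENNReal.ofReal (√(deriv (fun τ => P.coords s (γ τ)) t ⬝ᵥ
      (P.g s (P.coords s (γ t)) *ᵥ deriv (fun τ => P.coords s (γ τ)) t)))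

/-- The intrinsic distance `d_X`: the supremum, over the null sets `Z` containing the skeleton, of
the infimum of the lengths of the Lipschitz paths from `p` to `q` which are transversal to `Z`. -/
def intrinsicDist (p q : X) : ℝ≥0∞ :=
  ⨆ (Z : Set X) (_ : P.IsNull Z) (_ : P.skeleton ⊆ Z),
    ⨅ (γ : ℝ → X) (_ : γ 0 = p) (_ : γ 1 = q) (_ : P.IsLipPath γ) (_ : IsTransversalPath γ Z),
      P.pathLength γ

/-! ### Energy and maps locally of finite energy -/

section Energy

variable {Y : Type*}

open Classical in
/-- The approximate energy density at `p` of the restriction of `φ` to `U`, for a target with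
distance function `dY`:
the integral over `q ∈ B(p, ε) ∩ U` of `dY (φ p) (φ q) ^ 2 / ε ^ (m + 2)`. -/
def approxEnergyDensity (dY : Y → Y → ℝ≥0∞) (U : Set X) (φ : X → Y) (ε : ℝ) (p : X) : ℝ≥0∞ :=
  P.volIntegral fun q =>
    if q ∈ U ∧ P.intrinsicDist p q < ENNReal.ofReal ε then
      dY (φ p) (φ q) ^ 2 / ENNReal.ofReal ε ^ (m + 2)
    else 0

/-- The Korevaar–Schoen energy of the restriction of `φ` to the open set `U`, i.e. the supremum over
`f ∈ C_c(U, [0, 1])` of the upper limits, as `ε → 0+`, of the integrals of `f` against the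
approximate energy densities. -/
def energy (dY : Y → Y → ℝ≥0∞) (U : Set X) (φ : X → Y) : ℝ≥0∞ :=
  ⨆ (f : X → ℝ) (_ : Continuous f) (_ : HasCompactSupport f) (_ : tsupport f ⊆ U)
    (_ : ∀ p, f p ∈ Icc (0 : ℝ) 1),
      limsup (fun ε : ℝ => P.volIntegral fun p =>
        ENNReal.ofReal (f p) * P.approxEnergyDensity dY U φ ε p) (𝓝[>] 0)

/-- A continuous map on the open set `O` is of class `W^{1,2}_loc` (locally of finite energy) if its
restriction to every domain `U` which is relatively compact in `O` has finite energy. (For a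
continuous map, membership in `L²_loc` is automatic.) -/
def IsW12LocDist (dY : Y → Y → ℝ≥0∞) (O : Set X) (φ : X → Y) : Prop :=
  ∀ U : Set X, IsOpen U → IsConnected U → IsCompact (closure U) → closure U ⊆ O →
    P.energy dY U φ < ⊤

end Energy

/-! ### Weak gradients -/

/-- The gradient vector, in the coordinates of the simplex `s` at the point `x`, of a function with
differential `ξ`, that is, `∇^i = g^{ij} ξ_j`. -/
def gradOfDiff (s : P.Top) (x : Fin m → ℝ) (ξ : Fin m → ℝ) : Fin m → ℝ :=
  (P.g s x)⁻¹ *ᵥ ξ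

/-- The inner product `⟨a, b⟩ = g_ij a^i b^j` of tangent vectors at the point `x` of `s`. -/
def metricInner (s : P.Top) (x : Fin m → ℝ) (a b : Fin m → ℝ) : ℝ :=
  a ⬝ᵥ (P.g s x *ᵥ b)

end AdmissibleRiemannianPolyhedron

/-- `D = (∂_1 u, …, ∂_m u)` is the weak differential of `u` on the open set `Ω ⊆ ℝ^m`, in the sense
of distributions. -/
def HasWeakDiff {m : ℕ} (Ω : Set (Fin m → ℝ)) (u : (Fin m → ℝ) → ℝ)
    (D : (Fin m → ℝ) → Fin m → ℝ) : Prop :=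
  LocallyIntegrableOn u Ω ∧ LocallyIntegrableOn D Ω ∧
    ∀ η : (Fin m → ℝ) → ℝ, ContDiff ℝ ((⊤ : ℕ∞) : WithTop ℕ∞) η → HasCompactSupport η → tsupport η ⊆ Ω →
      ∀ i, ∫ x, u x * fderiv ℝ η x (Pi.single i 1) = - ∫ x, D x i * η x

/-! ### Hermitian manifolds and local holomorphic functions -/

section Hermitian

/-- The real manifold underlying a complex manifold is analytic. -/
instance isManifold_real_of_complex {E : Type*} [NormedAddCommGroup E] [NormedSpace ℂ E]
    {N : Type*} [TopologicalSpace N] [ChartedSpace E N] [IsManifold 𝓘(ℂ, E) ω N] :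
    IsManifold 𝓘(ℝ, E) ω N := by
  refine isManifold_of_contDiffOn 𝓘(ℝ, E) ω N fun e e' he he' => ?_
  have h := (contDiffGroupoid ω 𝓘(ℂ, E)).compatible he he'
  rw [contDiffGroupoid, mem_groupoid_of_pregroupoid] at h
  exact h.1.restrict_scalars ℝ

variable (E : Type*) [NormedAddCommGroup E] [NormedSpace ℂ E]
  (N : Type*) [TopologicalSpace N] [ChartedSpace E N]

/-- The complex structure `J` of a tangent space of a complex manifold. -/
def complexStructure (x : N) (v : TangentSpace 𝓘(ℝ, E) x) : TangentSpace 𝓘(ℝ, E) x :=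
  show E from Complex.I • (show E from v)

/-- A Riemannian metric on a complex manifold is Hermitian if `g (J v) (J w) = g v w`. -/
def IsHermitianMetric [RiemannianBundle (fun x : N => TangentSpace 𝓘(ℝ, E) x)] : Prop :=
  ∀ (x : N) (v w : TangentSpace 𝓘(ℝ, E) x),
    inner ℝ (complexStructure E N x v) (complexStructure E N x w) = inner ℝ v w

variable {N}

/-- `ψ` is holomorphic (complex analytic) on the open set `V`. -/
def IsLocalHolomorphic (V : Set N) (ψ : N → ℂ) : Prop :=
  IsOpen V ∧ ContMDiffOn 𝓘(ℂ, E) 𝓘(ℂ, ℂ) ω ψ V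

end Hermitian

/-! ### Pseudo-horizontally weakly conformal maps -/

namespace AdmissibleRiemannianPolyhedron

variable {X : Type*} [TopologicalSpace X] {m : ℕ} (P : AdmissibleRiemannianPolyhedron X m)
  (E : Type*) [NormedAddCommGroup E] [NormedSpace ℂ E]
  {N : Type*} [TopologicalSpace N] [ChartedSpace E N]

/-- The class `W^{1,2}_loc(O, N)` for a complex manifold `N` with a Riemannian metric, which carries
the distance induced by the metric. -/
def IsW12Loc [RiemannianBundle (fun x : N => TangentSpace 𝓘(ℝ, E) x)]
    (O : Set X) (φ : X → N) : Prop :=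
  P.IsW12LocDist (riemannianEDist 𝓘(ℝ, E)) O φ

/-- The identities of pseudo-horizontal weak conformality for the map `φ` on the open set `O` and
two functions `v = v₁ + i v₂` and `w = w₁ + i w₂` on `N`: on every open `m`-simplex, the functions
`v_k ∘ φ` and `w_k ∘ φ` have weak differentials (necessarily unique up to null sets), and the
corresponding gradients satisfy
`⟨∇(w₁ ∘ φ), ∇(v₁ ∘ φ)⟩ - ⟨∇(w₂ ∘ φ), ∇(v₂ ∘ φ)⟩ = 0` and
`⟨∇(w₂ ∘ φ), ∇(v₁ ∘ φ)⟩ + ⟨∇(w₁ ∘ φ), ∇(v₂ ∘ φ)⟩ = 0` almost everywhere in `O`. -/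
def ConformalPair {N : Type*} (O : Set X) (φ : X → N) (v w : N → ℂ) : Prop :=
  ∀ s : P.Top, ∃ dv₁ dv₂ dw₁ dw₂ : (Fin m → ℝ) → Fin m → ℝ,
    HasWeakDiff (openStdSimplex m ∩ P.param s ⁻¹' O) (fun x => (v (φ (P.param s x))).re) dv₁ ∧
    HasWeakDiff (openStdSimplex m ∩ P.param s ⁻¹' O) (fun x => (v (φ (P.param s x))).im) dv₂ ∧
    HasWeakDiff (openStdSimplex m ∩ P.param s ⁻¹' O) (fun x => (w (φ (P.param s x))).re) dw₁ ∧
    HasWeakDiff (openStdSimplex m ∩ P.param s ⁻¹' O) (fun x => (w (φ (P.param s x))).im) dw₂ ∧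
    ∀ᵐ x, x ∈ openStdSimplex m ∩ P.param s ⁻¹' O →
      P.metricInner s x (P.gradOfDiff s x (dw₁ x)) (P.gradOfDiff s x (dv₁ x)) -
        P.metricInner s x (P.gradOfDiff s x (dw₂ x)) (P.gradOfDiff s x (dv₂ x)) = 0 ∧
      P.metricInner s x (P.gradOfDiff s x (dw₂ x)) (P.gradOfDiff s x (dv₁ x)) +
        P.metricInner s x (P.gradOfDiff s x (dw₁ x)) (P.gradOfDiff s x (dv₂ x)) = 0

/-- A map `φ : O → N` on an open set `O` of the polyhedron (values of `φ` outside `O` are irrelevant)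
is pseudo-horizontally weakly conformal if it is continuous, of class `W^{1,2}_loc`, and satisfies
the identities above for all local holomorphic functions `v` on `V` and `w` on `W`, almost
everywhere where both `v ∘ φ` and `w ∘ φ` are defined. -/
def IsPHWC [RiemannianBundle (fun x : N => TangentSpace 𝓘(ℝ, E) x)]
    (O : Set X) (φ : X → N) : Prop :=
  ContinuousOn φ O ∧ P.IsW12Loc E O φ ∧
    ∀ (V W : Set N) (v w : N → ℂ), IsLocalHolomorphic E V v → IsLocalHolomorphic E W w →
      P.ConformalPair (O ∩ φ ⁻¹' (V ∩ W)) φ v w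

end AdmissibleRiemannianPolyhedron

end

/-!
Extend the inner product of the gradients complex bilinearly: the two identities then say that the
complex gradients of `v ∘ φ` and `w ∘ φ` are orthogonal. This form is symmetric, so by polarization
it suffices to know that the complex gradient of `ψ ∘ φ` is isotropic for `ψ = v`, `w` and `v + w`,
which is the conformality of `ψ ∘ φ` tested on the identity of `ℂ`. Conversely, testing `ψ ∘ φ` on
`v` and `w` amounts to testing `φ` on `v ∘ ψ` and `w ∘ ψ`. The analytic point is that `ψ ∘ φ` is
again locally of finite energy: a holomorphic function is locally Lipschitz for the Riemannian
distance, hence Lipschitz on the compact image under `φ` of the closure of a domain.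
-/

theorem integrable_mul_of_locallyIntegrableOn {Y R : Type*} [TopologicalSpace Y] [T2Space Y]
    [MeasurableSpace Y] [OpensMeasurableSpace Y] [NormedRing R] [SecondCountableTopologyEither Y R]
    {μ : Measure Y} {Ω : Set Y} {u η : Y → R} (hu : LocallyIntegrableOn u Ω μ)
    (hη : Continuous η) (hc : HasCompactSupport η) (hΩ : tsupport η ⊆ Ω) :
    Integrable (fun x => u x * η x) μ := by
  have hint : IntegrableOn (fun x => u x * η x) (tsupport η) μ :=
    (hu.integrableOn_compact_subset hΩ hc).mul_continuousOn hη.continuousOn hc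
  refine (integrableOn_iff_integrable_of_support_subset ?_).1 hint
  exact (Function.support_mul_subset_right u η).trans (subset_tsupport η)

theorem locallyIntegrableOn_eval {Y ι : Type*} [TopologicalSpace Y] [MeasurableSpace Y]
    [Fintype ι] {F : ι → Type*} [∀ i, NormedAddCommGroup (F i)] {μ : Measure Y} {Ω : Set Y}
    {D : Y → ∀ i, F i} (hD : LocallyIntegrableOn D Ω μ) (i : ι) :
    LocallyIntegrableOn (fun x => D x i) Ω μ := fun x hx =>
  let ⟨t, ht, hint⟩ := hD x hx
  ⟨t, ht, Integrable.eval hint i⟩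

namespace HasWeakDiff

variable {m : ℕ} {Ω : Set (Fin m → ℝ)} {u v : (Fin m → ℝ) → ℝ} {D D' : (Fin m → ℝ) → Fin m → ℝ}

theorem add (hu : HasWeakDiff Ω u D) (hv : HasWeakDiff Ω v D') :
    HasWeakDiff Ω (fun x => u x + v x) (fun x => D x + D' x) := by
  refine ⟨hu.1.add hv.1, hu.2.1.add hv.2.1, fun η hη hc hs i => ?_⟩
  have hint : ∀ {w : (Fin m → ℝ) → ℝ}, LocallyIntegrableOn w Ω →
      Integrable (fun x => w x * fderiv ℝ η x (Pi.single i 1)) := fun hw =>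
    integrable_mul_of_locallyIntegrableOn hw
      ((hη.continuous_fderiv (by simp)).clm_apply continuous_const) (hc.fderiv_apply ℝ _)
      ((tsupport_fderiv_apply_subset ℝ _).trans hs)
  have hint' : ∀ {G : (Fin m → ℝ) → Fin m → ℝ}, LocallyIntegrableOn G Ω →
      Integrable (fun x => G x i * η x) := fun hG =>
    integrable_mul_of_locallyIntegrableOn (locallyIntegrableOn_eval hG i) hη.continuous hc hs
  simp only [add_mul, Pi.add_apply]
  rw [integral_add (hint hu.1) (hint hv.1), integral_add (hint' hu.2.1) (hint' hv.2.1),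
    hu.2.2 η hη hc hs i, hv.2.2 η hη hc hs i, neg_add]

theorem ae_unique (hΩ : IsOpen Ω) (hD : HasWeakDiff Ω u D) (hD' : HasWeakDiff Ω u D') :
    ∀ᵐ x, x ∈ Ω → D x = D' x := by
  have hcoord : ∀ i, ∀ᵐ x, x ∈ Ω → D x i - D' x i = 0 := fun i => by
    have hloc := locallyIntegrableOn_eval hD.2.1 i
    have hloc' := locallyIntegrableOn_eval hD'.2.1 i
    refine hΩ.ae_eq_zero_of_integral_contDiff_smul_eq_zero (hloc.sub hloc') fun η hη hc hs => ?_
    have heq : ∫ x, D x i * η x = ∫ x, D' x i * η x :=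
      neg_injective ((hD.2.2 η hη hc hs i).symm.trans (hD'.2.2 η hη hc hs i))
    simp only [smul_eq_mul, mul_comm (η _), sub_mul]
    rw [integral_sub (integrable_mul_of_locallyIntegrableOn hloc hη.continuous hc hs)
      (integrable_mul_of_locallyIntegrableOn hloc' hη.continuous hc hs), heq, sub_self]
  filter_upwards [ae_all_iff.2 hcoord] with x hx hxΩ
  exact funext fun i => sub_eq_zero.1 (hx i hxΩ)

end HasWeakDiff

section Polarization

variable {R M : Type*} [CommRing R] [AddCommGroup M] [Module R M]
  {B : LinearMap.BilinForm R M} {a₁ a₂ b₁ b₂ : M}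

/-- Orthogonality of the complex vectors `b₁ + i b₂` and `a₁ + i a₂` for the complex bilinear (not
sesquilinear) extension of the form `B`: the two equations are the real and the imaginary part of
`B (b₁ + i b₂) (a₁ + i a₂) = 0`. -/
def ComplexIsOrtho (B : LinearMap.BilinForm R M) (a₁ a₂ b₁ b₂ : M) : Prop :=
  B b₁ a₁ - B b₂ a₂ = 0 ∧ B b₂ a₁ + B b₁ a₂ = 0

theorem ComplexIsOrtho.polarize [Invertible (2 : R)] (hB : B.IsSymm)
    (ha : ComplexIsOrtho B a₁ a₂ a₁ a₂) (hb : ComplexIsOrtho B b₁ b₂ b₁ b₂)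
    (hab : ComplexIsOrtho B (a₁ + b₁) (a₂ + b₂) (a₁ + b₁) (a₂ + b₂)) :
    ComplexIsOrtho B a₁ a₂ b₁ b₂ := by
  have htwo : ∀ {c : R}, 2 * c = 0 → c = 0 := (isUnit_of_invertible 2).mul_right_eq_zero.1
  obtain ⟨hre, him⟩ := hab
  simp only [map_add, LinearMap.add_apply, hB.eq a₁ b₁, hB.eq a₁ b₂, hB.eq a₂ b₁, hB.eq a₂ b₂]
    at hre him
  exact ⟨htwo (by linear_combination hre - ha.1 - hb.1),
    htwo (by linear_combination him - ha.2 - hb.2)⟩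

end Polarization

theorem openStdSimplex_subset_closedStdSimplex (m : ℕ) : openStdSimplex m ⊆ closedStdSimplex m :=
  fun _ hx => ⟨fun i => (hx.1 i).le, hx.2.le⟩

theorem isOpen_openStdSimplex (m : ℕ) : IsOpen (openStdSimplex m) := by
  have heq : openStdSimplex m = (⋂ i, {x | 0 < x i}) ∩ {x | ∑ i, x i < 1} := by
    ext x
    simp [openStdSimplex]
  rw [heq]
  exact (isOpen_iInter_of_finite fun i => isOpen_lt continuous_const (continuous_apply i)).inter
    (isOpen_lt (by fun_prop) continuous_const)

namespace AdmissibleRiemannianPolyhedron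

variable {X : Type*} [TopologicalSpace X] {m : ℕ} (P : AdmissibleRiemannianPolyhedron X m)

theorem affineMap_eq_sum_barycentric (s : P.Top) (x : Fin m → ℝ) :
    P.affineMap s x =
      ∑ j, (Fin.cons (1 - ∑ i, x i) x : Fin (m + 1) → ℝ) j • P.vert s j := by
  simp only [affineMap, Fin.sum_univ_succ, Fin.cons_zero, Fin.cons_succ, smul_sub,
    Finset.sum_sub_distrib, sub_smul, one_smul, Finset.sum_smul]
  abel

theorem affineMap_mem_convexHull (s : P.Top) {x : Fin m → ℝ} (hx : x ∈ closedStdSimplex m) :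
    P.affineMap s x ∈ convexHull ℝ (s.1 : Set P.Amb) := by
  rw [affineMap_eq_sum_barycentric]
  refine (convex_convexHull ℝ _).sum_mem (fun j _ => ?_) ?_ fun j _ =>
    subset_convexHull ℝ _ (P.range_vert s ▸ mem_range_self j)
  · exact Fin.cases (by simpa using hx.2) (fun i => by simpa using hx.1 i) j
  · simp only [Fin.sum_univ_succ, Fin.cons_zero, Fin.cons_succ, sub_add_cancel]

theorem continuous_affineMap (s : P.Top) : Continuous (P.affineMap s) :=
  continuous_const.add <| continuous_finsetSum _ fun i _ =>
    (continuous_apply i).smul continuous_const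

theorem continuousOn_param (s : P.Top) : ContinuousOn (P.param s) (closedStdSimplex m) := by
  have hmem : ∀ x : closedStdSimplex m, P.affineMap s x ∈ P.K.space := fun x =>
    P.K.convexHull_subset_space s.2.1 (P.affineMap_mem_convexHull s x.2)
  have hparam : (closedStdSimplex m).domRestrict (P.param s) =
      fun x : closedStdSimplex m => P.θ ⟨P.affineMap s x, hmem x⟩ := by
    ext x
    exact dif_pos (hmem x)
  rw [continuousOn_iff_continuous_domRestrict, hparam]
  exact P.θ.continuous.comp
    (((P.continuous_affineMap s).comp continuous_subtype_val).subtype_mk hmem)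

theorem isOpen_openStdSimplex_inter_preimage (s : P.Top) {O : Set X} (hO : IsOpen O) :
    IsOpen (openStdSimplex m ∩ P.param s ⁻¹' O) :=
  ((P.continuousOn_param s).mono
    (openStdSimplex_subset_closedStdSimplex m)).isOpen_inter_preimage (isOpen_openStdSimplex m) hO

/-- The inner product `⟨∇f, ∇h⟩` at the point `x` of the simplex `s`, as a bilinear form in the
differentials of the functions `f` and `h`. -/
noncomputable def gradForm (s : P.Top) (x : Fin m → ℝ) : LinearMap.BilinForm ℝ (Fin m → ℝ) :=
  LinearMap.mk₂ ℝ (fun ξ η => P.metricInner s x (P.gradOfDiff s x ξ) (P.gradOfDiff s x η))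
    (fun ξ ξ' η => by simp only [metricInner, gradOfDiff, Matrix.mulVec_add, add_dotProduct])
    (fun c ξ η => by simp only [metricInner, gradOfDiff, Matrix.mulVec_smul, smul_dotProduct])
    (fun ξ η η' => by simp only [metricInner, gradOfDiff, Matrix.mulVec_add, dotProduct_add])
    (fun c ξ η => by simp only [metricInner, gradOfDiff, Matrix.mulVec_smul, dotProduct_smul])

theorem metricInner_comm (s : P.Top) {x : Fin m → ℝ} (hx : x ∈ closedStdSimplex m)
    (a b : Fin m → ℝ) : P.metricInner s x a b = P.metricInner s x b a := by
  have hsymm : (P.g s x)ᵀ = P.g s x := (P.g_posDef s x hx).isHermitian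
  rw [metricInner, metricInner, Matrix.dotProduct_mulVec, ← Matrix.mulVec_transpose, hsymm,
    dotProduct_comm]

theorem isSymm_gradForm (s : P.Top) {x : Fin m → ℝ} (hx : x ∈ closedStdSimplex m) :
    (P.gradForm s x).IsSymm :=
  ⟨fun _ _ => P.metricInner_comm s hx _ _⟩

variable {P}

theorem ConformalPair.ae_complexIsOrtho {N : Type*} {O : Set X} (hO : IsOpen O) {φ : X → N}
    {v w : N → ℂ} (h : P.ConformalPair O φ v w) (s : P.Top)
    {dv₁ dv₂ dw₁ dw₂ : (Fin m → ℝ) → Fin m → ℝ}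
    (hv₁ : HasWeakDiff (openStdSimplex m ∩ P.param s ⁻¹' O)
      (fun x => (v (φ (P.param s x))).re) dv₁)
    (hv₂ : HasWeakDiff (openStdSimplex m ∩ P.param s ⁻¹' O)
      (fun x => (v (φ (P.param s x))).im) dv₂)
    (hw₁ : HasWeakDiff (openStdSimplex m ∩ P.param s ⁻¹' O)
      (fun x => (w (φ (P.param s x))).re) dw₁)
    (hw₂ : HasWeakDiff (openStdSimplex m ∩ P.param s ⁻¹' O)
      (fun x => (w (φ (P.param s x))).im) dw₂) :
    ∀ᵐ x, x ∈ openStdSimplex m ∩ P.param s ⁻¹' O →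
      ComplexIsOrtho (P.gradForm s x) (dv₁ x) (dv₂ x) (dw₁ x) (dw₂ x) := by
  have hΩ := P.isOpen_openStdSimplex_inter_preimage s hO
  obtain ⟨dv₁', dv₂', dw₁', dw₂', hv₁', hv₂', hw₁', hw₂', hae⟩ := h s
  filter_upwards [hae, hv₁.ae_unique hΩ hv₁', hv₂.ae_unique hΩ hv₂', hw₁.ae_unique hΩ hw₁',
    hw₂.ae_unique hΩ hw₂'] with x hx ev₁ ev₂ ew₁ ew₂ hxΩ
  rw [ev₁ hxΩ, ev₂ hxΩ, ew₁ hxΩ, ew₂ hxΩ]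
  exact hx hxΩ

theorem ConformalPair.polarize {N : Type*} {O : Set X} (hO : IsOpen O) {φ : X → N} {v w : N → ℂ}
    (hv : P.ConformalPair O φ v v) (hw : P.ConformalPair O φ w w)
    (hvw : P.ConformalPair O φ (v + w) (v + w)) : P.ConformalPair O φ v w := by
  intro s
  obtain ⟨dv₁, dv₂, -, -, hv₁, hv₂, -⟩ := hv s
  obtain ⟨dw₁, dw₂, -, -, hw₁, hw₂, -⟩ := hw s
  refine ⟨dv₁, dv₂, dw₁, dw₂, hv₁, hv₂, hw₁, hw₂, ?_⟩
  filter_upwards [hv.ae_complexIsOrtho hO s hv₁ hv₂ hv₁ hv₂,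
    hw.ae_complexIsOrtho hO s hw₁ hw₂ hw₁ hw₂,
    hvw.ae_complexIsOrtho hO s (hv₁.add hw₁) (hv₂.add hw₂) (hv₁.add hw₁) (hv₂.add hw₂)]
    with x hxv hxw hxvw hx
  exact (hxv hx).polarize
    (P.isSymm_gradForm s (openStdSimplex_subset_closedStdSimplex m hx.1)) (hxw hx) (hxvw hx)

section Energy

variable {Y Z : Type*} {dY : Y → Y → ℝ≥0∞} {dZ : Z → Z → ℝ≥0∞} {U : Set X} {φ : X → Y} {ψ : X → Z}
  {C : ℝ≥0}

theorem volIntegral_mono {F G : X → ℝ≥0∞} (h : ∀ p, F p ≤ G p) :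
    P.volIntegral F ≤ P.volIntegral G := by
  unfold volIntegral
  gcongr
  exact h _

theorem volIntegral_const_mul {c : ℝ≥0∞} (hc : c ≠ ⊤) (F : X → ℝ≥0∞) :
    P.volIntegral (fun p => c * F p) = c * P.volIntegral F := by
  simp only [volIntegral, mul_assoc, lintegral_const_mul' c _ hc, ENNReal.tsum_mul_left]

theorem approxEnergyDensity_le_of_dist_le {p : X}
    (h : ∀ q ∈ U, dZ (ψ p) (ψ q) ≤ C * dY (φ p) (φ q)) (ε : ℝ) :
    P.approxEnergyDensity dZ U ψ ε p ≤ C ^ 2 * P.approxEnergyDensity dY U φ ε p := by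
  rw [approxEnergyDensity, approxEnergyDensity, ← volIntegral_const_mul (by finiteness)]
  refine volIntegral_mono fun q => ?_
  split_ifs with hq
  · rw [← mul_div_assoc, ← mul_pow]
    gcongr
    exact h q hq.1
  · exact zero_le

theorem energy_le_of_dist_le (h : ∀ p ∈ U, ∀ q ∈ U, dZ (ψ p) (ψ q) ≤ C * dY (φ p) (φ q)) :
    P.energy dZ U ψ ≤ C ^ 2 * P.energy dY U φ := by
  refine iSup_le fun f => iSup₂_le fun hf hc => iSup₂_le fun hs h01 => ?_
  have hdensity : ∀ ε : ℝ,
      (P.volIntegral fun p => ENNReal.ofReal (f p) * P.approxEnergyDensity dZ U ψ ε p) ≤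
        C ^ 2 * P.volIntegral fun p =>
          ENNReal.ofReal (f p) * P.approxEnergyDensity dY U φ ε p := fun ε => by
    rw [← volIntegral_const_mul (by finiteness)]
    refine volIntegral_mono fun p => ?_
    by_cases hp : p ∈ U
    · rw [mul_left_comm]
      gcongr
      exact approxEnergyDensity_le_of_dist_le (h p hp) ε
    · simp [image_eq_zero_of_notMem_tsupport fun hpf => hp (hs hpf)]
  calc limsup (fun ε : ℝ => P.volIntegral fun p =>
        ENNReal.ofReal (f p) * P.approxEnergyDensity dZ U ψ ε p) (𝓝[>] 0)
    _ ≤ limsup (fun ε : ℝ => C ^ 2 * P.volIntegral fun p =>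
        ENNReal.ofReal (f p) * P.approxEnergyDensity dY U φ ε p) (𝓝[>] 0) :=
      limsup_le_limsup (Eventually.of_forall hdensity)
    _ = C ^ 2 * limsup (fun ε : ℝ => P.volIntegral fun p =>
        ENNReal.ofReal (f p) * P.approxEnergyDensity dY U φ ε p) (𝓝[>] 0) :=
      ENNReal.limsup_const_mul_of_ne_top (by finiteness)
    _ ≤ C ^ 2 * P.energy dY U φ := by
      gcongr
      exact le_iSup_of_le f (le_iSup₂_of_le hf hc (le_iSup₂_of_le hs h01 le_rfl))

theorem IsW12LocDist.of_dist_le_on_compacts {O O' : Set X} (hφ : P.IsW12LocDist dY O φ)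
    (hO : O' ⊆ O) (h : ∀ K ⊆ O', IsCompact K →
      ∃ C : ℝ≥0, ∀ p ∈ K, ∀ q ∈ K, dZ (ψ p) (ψ q) ≤ C * dY (φ p) (φ q)) :
    P.IsW12LocDist dZ O' ψ := by
  intro U hU hUconn hUcpt hUO
  obtain ⟨C, hC⟩ := h _ hUO hUcpt
  calc P.energy dZ U ψ
    _ ≤ C ^ 2 * P.energy dY U φ := energy_le_of_dist_le fun p hp q hq =>
      hC p (subset_closure hp) q (subset_closure hq)
    _ < ⊤ := ENNReal.mul_lt_top (by finiteness) (hφ U hU hUconn hUcpt (hUO.trans hO))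

end Energy

end AdmissibleRiemannianPolyhedron

section LocallyLipschitz

variable {α β : Type*} [PseudoEMetricSpace α] {f : α → β} {s : Set α}

theorem exists_edist_le_mul_of_edist_lt_of_isCompact [PseudoEMetricSpace β] (hs : IsCompact s)
    (hf : LocallyLipschitzOn s f) :
    ∃ C : ℝ≥0, ∃ δ > 0, ∀ y ∈ s, ∀ z ∈ s, edist y z < δ → edist (f y) (f z) ≤ C * edist y z := by
  refine hs.induction_on (p := fun t => ∃ C : ℝ≥0, ∃ δ > 0, ∀ y ∈ t, ∀ z ∈ s,
    edist y z < δ → edist (f y) (f z) ≤ C * edist y z) ?empty ?mono ?union ?nhds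
  case empty => exact ⟨0, 1, one_pos, by simp⟩
  case mono => exact fun t t' htt' ⟨C, δ, hδ, h⟩ => ⟨C, δ, hδ, fun y hy => h y (htt' hy)⟩
  case union =>
    rintro t t' ⟨C, δ, hδ, h⟩ ⟨C', δ', hδ', h'⟩
    refine ⟨C ⊔ C', δ ⊓ δ', lt_min hδ hδ', fun y hy z hz hyz => ?_⟩
    rcases hy with hy | hy
    · exact (h y hy z hz (hyz.trans_le inf_le_left)).trans (by gcongr; exact le_sup_left)
    · exact (h' y hy z hz (hyz.trans_le inf_le_right)).trans (by gcongr; exact le_sup_right)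
  case nhds =>
    intro x hx
    obtain ⟨C, t, ht, hC⟩ := hf hx
    obtain ⟨ε, hε, hball⟩ := EMetric.mem_nhdsWithin_iff.1 ht
    have hε2 : 0 < ε / 2 := ENNReal.half_pos hε.ne'
    refine ⟨Metric.eball x (ε / 2) ∩ s, inter_mem
      (nhdsWithin_le_nhds (Metric.eball_mem_nhds x hε2)) self_mem_nhdsWithin, C, ε / 2, hε2, ?_⟩
    rintro y ⟨hyx, hys⟩ z hzs hyz
    have hzx : edist z x < ε := by
      rw [← ENNReal.add_halves ε]
      exact (edist_triangle_left z x y).trans_lt (ENNReal.add_lt_add hyz hyx)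
    exact hC (hball ⟨Metric.eball_subset_eball ENNReal.half_le_self hyx, hys⟩) (hball ⟨hzx, hzs⟩)

theorem exists_lipschitzOnWith_of_isCompact [PseudoMetricSpace β] (hs : IsCompact s)
    (hf : LocallyLipschitzOn s f) : ∃ C, LipschitzOnWith C f s := by
  obtain ⟨C, δ, hδ, hC⟩ := exists_edist_le_mul_of_edist_lt_of_isCompact hs hf
  obtain ⟨r, hr, hrδ⟩ := ENNReal.lt_iff_exists_nnreal_btwn.1 hδ
  obtain ⟨D, hD⟩ :=
    Metric.isBounded_iff_nndist.1 (hs.image_of_continuousOn hf.continuousOn).isBounded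
  refine ⟨C ⊔ D / r, fun y hy z hz => ?_⟩
  rcases lt_or_ge (edist y z) δ with hyz | hyz
  · exact (hC y hy z hz hyz).trans (by gcongr; exact le_sup_left)
  · calc edist (f y) (f z)
      _ ≤ D := by
        rw [edist_nndist]
        exact mod_cast hD (mem_image_of_mem f hy) (mem_image_of_mem f hz)
      _ = ↑(D / r) * r := by rw [← ENNReal.coe_mul, div_mul_cancel₀ _ (by simpa using hr.ne')]
      _ ≤ ↑(C ⊔ D / r) * edist y z := by
        gcongr
        · exact le_sup_right
        · exact hrδ.le.trans hyz

end LocallyLipschitz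

theorem contMDiffOn_restrictScalars (𝕜 : Type*) {𝕜' E E' M M' : Type*}
    [NontriviallyNormedField 𝕜] [NontriviallyNormedField 𝕜'] [NormedAlgebra 𝕜 𝕜']
    [NormedAddCommGroup E] [NormedSpace 𝕜 E] [NormedSpace 𝕜' E] [IsScalarTower 𝕜 𝕜' E]
    [NormedAddCommGroup E'] [NormedSpace 𝕜 E'] [NormedSpace 𝕜' E'] [IsScalarTower 𝕜 𝕜' E']
    [TopologicalSpace M] [ChartedSpace E M] [TopologicalSpace M'] [ChartedSpace E' M']
    {n : ℕ∞ω} {f : M → M'} {s : Set M} (hf : ContMDiffOn 𝓘(𝕜', E) 𝓘(𝕜', E') n f s) :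
    ContMDiffOn 𝓘(𝕜, E) 𝓘(𝕜, E') n f s :=
  fun x hx => ⟨(hf x hx).1, (hf x hx).2.restrict_scalars 𝕜⟩

theorem isContinuousRiemannianBundle_of_isContMDiffRiemannianBundle {EB HB B : Type*}
    [NormedAddCommGroup EB] [NormedSpace ℝ EB] [TopologicalSpace HB] (IB : ModelWithCorners ℝ EB HB)
    [TopologicalSpace B] [ChartedSpace HB B] (n : ℕ∞ω) (F : Type*)
    [NormedAddCommGroup F] [NormedSpace ℝ F] (V : B → Type*) [TopologicalSpace (TotalSpace F V)]
    [∀ x, NormedAddCommGroup (V x)] [∀ x, InnerProductSpace ℝ (V x)]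
    [FiberBundle F V] [VectorBundle ℝ F V]
    [IsContMDiffRiemannianBundle IB n F V] : IsContinuousRiemannianBundle F V :=
  let ⟨g, hg, hinner⟩ := IsContMDiffRiemannianBundle.exists_contMDiff (IB := IB) (n := n) (F := F)
    (E := V)
  ⟨g, hg.continuous, hinner⟩

section Riemannian

variable {E : Type*} [NormedAddCommGroup E] [NormedSpace ℝ E]
  {H : Type*} [TopologicalSpace H] {I : ModelWithCorners ℝ E H}
  {F : Type*} [NormedAddCommGroup F] [NormedSpace ℝ F]

section PathLength

variable {M : Type*} [TopologicalSpace M] [ChartedSpace H M] {f : M → F} {γ : ℝ → M} {a b : ℝ}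

theorem derivWithin_Icc_comp {t : ℝ} (hf : MDifferentiableAt I 𝓘(ℝ, F) f (γ t))
    (hγ : MDifferentiableWithinAt 𝓘(ℝ, ℝ) I γ (Icc a b) t) (hab : a < b) (ht : t ∈ Icc a b) :
    derivWithin (f ∘ γ) (Icc a b) t =
      mfderiv I 𝓘(ℝ, F) f (γ t) (mfderivWithin 𝓘(ℝ, ℝ) I γ (Icc a b) t 1) := by
  have hu : UniqueMDiffWithinAt 𝓘(ℝ, ℝ) (Icc a b) t :=
    (uniqueDiffOn_Icc hab t ht).uniqueMDiffWithinAt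
  rw [← fderivWithin_derivWithin, ← mfderivWithin_eq_fderivWithin]
  exact DFunLike.congr_fun (mfderiv_comp_mfderivWithin t hf hγ hu) 1

variable [RiemannianBundle (fun x : M => TangentSpace I x)]

theorem edist_comp_le_mul_pathELength {s : Set M} (hs : IsOpen s) (hf : ContMDiffOn I 𝓘(ℝ, F) 1 f s)
    {C : ℝ≥0} (hC : ∀ y ∈ s, ∀ v : TangentSpace I y,
      enorm (E := F) (mfderiv I 𝓘(ℝ, F) f y v) ≤ C * ‖v‖ₑ)
    (hab : a < b) (hγ : ContMDiffOn 𝓘(ℝ, ℝ) I 1 γ (Icc a b)) (hγs : MapsTo γ (Icc a b) s) :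
    edist (f (γ a)) (f (γ b)) ≤ C * pathELength I γ a b := by
  have hdiff : ∀ y ∈ s, MDifferentiableAt I 𝓘(ℝ, F) f y := fun y hy =>
    (hf.contMDiffAt (hs.mem_nhds hy)).mdifferentiableAt one_ne_zero
  calc edist (f (γ a)) (f (γ b))
    _ = ‖(f ∘ γ) b - (f ∘ γ) a‖ₑ := by rw [edist_comm, edist_eq_enorm_sub]; rfl
    _ ≤ ∫⁻ t in Icc a b, ‖derivWithin (f ∘ γ) (Icc a b) t‖ₑ :=
      enorm_sub_le_lintegral_derivWithin_Icc_of_contDiffOn_Icc (hf.comp hγ hγs).contDiffOn hab.le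
    _ ≤ ∫⁻ t in Icc a b, C * ‖mfderivWithin 𝓘(ℝ, ℝ) I γ (Icc a b) t 1‖ₑ := by
      refine setLIntegral_mono' measurableSet_Icc fun t ht => ?_
      rw [derivWithin_Icc_comp (hdiff _ (hγs ht)) (hγ.mdifferentiableOn one_ne_zero t ht) hab ht]
      exact hC _ (hγs ht) _
    _ = C * pathELength I γ a b := by
      rw [lintegral_const_mul' _ _ ENNReal.coe_ne_top, pathELength_eq_lintegral_mfderivWithin_Icc]

variable (I) in
theorem eventually_enorm_mfderiv_extChartAt_apply_le [IsManifold I 1 M]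
    [IsContinuousRiemannianBundle E (fun x : M => TangentSpace I x)] (x : M) :
    ∃ C : ℝ≥0, ∀ᶠ y in 𝓝 x, ∀ v : TangentSpace I y,
      enorm (E := E) (mfderiv I 𝓘(ℝ, E) (extChartAt I x) y v) ≤ C * ‖v‖ₑ := by
  obtain ⟨C, -, hC⟩ := eventually_enorm_mfderiv_extChartAt_lt I x
  refine ⟨C, hC.mono fun y hy v => ?_⟩
  exact (ContinuousLinearMap.le_opENorm _ _).trans (mul_le_mul_left hy.le _)

end PathLength

section Metric

variable {M : Type*} [PseudoEMetricSpace M] [ChartedSpace H M]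
  [RiemannianBundle (fun x : M => TangentSpace I x)] [IsRiemannianManifold I M]
  {f : M → F} {x : M} {s : Set M}

theorem mapsTo_eball_of_pathELength_lt {γ : ℝ → M} {a b : ℝ} {r ρ : ℝ≥0∞}
    (hγ : ContMDiffOn 𝓘(ℝ, ℝ) I 1 γ (Icc a b)) (hx : γ a ∈ Metric.eball x r)
    (hlen : pathELength I γ a b < ρ) :
    MapsTo γ (Icc a b) (Metric.eball x (ρ + r)) := fun t ht => by
  have hat : edist (γ t) (γ a) < ρ := by
    rw [edist_comm, IsRiemannianManifold.out (I := I)]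
    exact ((riemannianEDist_le_pathELength (hγ.mono (Icc_subset_Icc_right ht.2)) rfl rfl
      ht.1).trans (pathELength_mono le_rfl ht.2)).trans_lt hlen
  exact (edist_triangle _ _ _).trans_lt (ENNReal.add_lt_add hat hx)

/-- Two points of the ball of radius `r` are joined by paths of length less than `2 * r`, which
cannot leave the ball of radius `3 * r`, where the derivative of `f` is bounded. -/
theorem lipschitzOnWith_eball_of_enorm_mfderiv_le {C : ℝ≥0} {r : ℝ≥0∞}
    (hf : ContMDiffOn I 𝓘(ℝ, F) 1 f (Metric.eball x (r + r + r)))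
    (hC : ∀ y ∈ Metric.eball x (r + r + r), ∀ v : TangentSpace I y,
      enorm (E := F) (mfderiv I 𝓘(ℝ, F) f y v) ≤ C * ‖v‖ₑ) :
    LipschitzOnWith C f (Metric.eball x r) := by
  intro y hy z hz
  have hyz : edist y z < r + r :=
    (edist_triangle_right y z x).trans_lt (ENNReal.add_lt_add hy hz)
  have hlt : ∀ ρ : ℝ≥0∞, edist y z < ρ → ρ < r + r → edist (f y) (f z) ≤ C * ρ := by
    intro ρ hρ hρr
    rw [IsRiemannianManifold.out (I := I)] at hρ
    obtain ⟨γ, rfl, rfl, hγ, hlen⟩ := exists_lt_of_riemannianEDist_lt hρ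
    refine (edist_comp_le_mul_pathELength Metric.isOpen_eball hf hC zero_lt_one hγ
      (mapsTo_eball_of_pathELength_lt hγ hy (hlen.trans hρr))).trans ?_
    gcongr
  have : (𝓝[>] edist y z).NeBot := nhdsGT_neBot_of_exists_gt ⟨_, hyz⟩
  have hlim : Tendsto (fun ρ : ℝ≥0∞ => C * ρ) (𝓝[>] edist y z) (𝓝 (C * edist y z)) :=
    ((ENNReal.continuous_const_mul ENNReal.coe_ne_top).tendsto _).mono_left nhdsWithin_le_nhds
  refine ge_of_tendsto hlim ?_
  filter_upwards [Ioo_mem_nhdsGT hyz] with ρ hρ using hlt ρ hρ.1 hρ.2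

variable [IsManifold I 1 M] [IsContinuousRiemannianBundle E (fun x : M => TangentSpace I x)]

variable (I) in
theorem exists_lipschitzOnWith_extChartAt (x : M) :
    ∃ C, ∃ s ∈ 𝓝 x, LipschitzOnWith C (extChartAt I x) s := by
  obtain ⟨C, hC⟩ := eventually_enorm_mfderiv_extChartAt_apply_le I x
  obtain ⟨R, hR, hball⟩ := EMetric.mem_nhds_iff.1 (inter_mem hC (chart_source_mem_nhds H x))
  rw [← ENNReal.add_thirds R] at hball
  exact ⟨C, _, Metric.eball_mem_nhds x (ENNReal.div_pos hR.ne' (by finiteness)),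
    lipschitzOnWith_eball_of_enorm_mfderiv_le
      (contMDiffOn_extChartAt.mono fun y hy => (hball hy).2) fun y hy => (hball hy).1⟩

theorem exists_lipschitzOnWith_of_contMDiffAt (hf : ContMDiffAt I 𝓘(ℝ, F) 1 f x) :
    ∃ C, ∃ s ∈ 𝓝 x, LipschitzOnWith C f s := by
  obtain ⟨C, s, hs, hC⟩ := exists_lipschitzOnWith_extChartAt I x
  obtain ⟨L, t, ht, hL⟩ : ∃ L, ∃ t ∈ 𝓝[range I] (extChartAt I x x),
      LipschitzOnWith L (f ∘ (extChartAt I x).symm) t :=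
    (contMDiffAt_iff.1 hf).2.exists_lipschitzOnWith I.convex_range
  have hpre : extChartAt I x ⁻¹' t ∈ 𝓝 x := by rwa [← mem_map, map_extChartAt_nhds]
  refine ⟨L * C, s ∩ extChartAt I x ⁻¹' t ∩ (extChartAt I x).source,
    inter_mem (inter_mem hs hpre) (extChartAt_source_mem_nhds x), ?_⟩
  have hcomp := hL.comp (hC.mono inter_subset_left) fun y hy => hy.2
  intro y hy z hz
  simpa only [Function.comp_apply, (extChartAt I x).left_inv hy.2, (extChartAt I x).left_inv hz.2]
    using hcomp hy.1 hz.1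

theorem locallyLipschitzOn_of_contMDiffOn (hs : IsOpen s) (hf : ContMDiffOn I 𝓘(ℝ, F) 1 f s) :
    LocallyLipschitzOn s f := fun x hx => by
  obtain ⟨C, t, ht, hC⟩ := exists_lipschitzOnWith_of_contMDiffAt (hf.contMDiffAt (hs.mem_nhds hx))
  exact ⟨C, t, nhdsWithin_le_nhds ht, hC⟩

end Metric

end Riemannian

section Holomorphic

variable {E : Type*} [NormedAddCommGroup E] [NormedSpace ℂ E]
  {N : Type*} [TopologicalSpace N] [ChartedSpace E N]

namespace IsLocalHolomorphic

variable {V W : Set N} {ψ ψ' : N → ℂ}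

theorem mono (hψ : IsLocalHolomorphic E V ψ) (hW : IsOpen W) (hWV : W ⊆ V) :
    IsLocalHolomorphic E W ψ :=
  ⟨hW, hψ.2.mono hWV⟩

theorem add (hψ : IsLocalHolomorphic E V ψ) (hψ' : IsLocalHolomorphic E V ψ') :
    IsLocalHolomorphic E V (ψ + ψ') :=
  ⟨hψ.1, hψ.2.add hψ'.2⟩

theorem comp {V' : Set ℂ} {v : ℂ → ℂ} (hv : IsLocalHolomorphic ℂ V' v)
    (hψ : IsLocalHolomorphic E V ψ) : IsLocalHolomorphic E (V ∩ ψ ⁻¹' V') (v ∘ ψ) :=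
  ⟨hψ.2.continuousOn.isOpen_inter_preimage hψ.1 hv.1,
    hv.2.comp (hψ.2.mono inter_subset_left) inter_subset_right⟩

theorem id : IsLocalHolomorphic ℂ (univ : Set ℂ) (id : ℂ → ℂ) :=
  ⟨isOpen_univ, contMDiffOn_id⟩

theorem exists_edist_le_riemannianEDist_of_isCompact [RegularSpace N] [IsManifold 𝓘(ℂ, E) ω N]
    [RiemannianBundle (fun x : N => TangentSpace 𝓘(ℝ, E) x)]
    [IsContinuousRiemannianBundle E (fun x : N => TangentSpace 𝓘(ℝ, E) x)] {K : Set N}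
    (hψ : IsLocalHolomorphic E V ψ) (hK : IsCompact K) (hKV : K ⊆ V) :
    ∃ C : ℝ≥0, ∀ y ∈ K, ∀ z ∈ K,
      riemannianEDist 𝓘(ℝ, ℂ) (ψ y) (ψ z) ≤ C * riemannianEDist 𝓘(ℝ, E) y z := by
  let : PseudoEMetricSpace N := .ofRiemannianMetric 𝓘(ℝ, E) N
  have hψℝ : ContMDiffOn 𝓘(ℝ, E) 𝓘(ℝ, ℂ) 1 ψ V :=
    contMDiffOn_restrictScalars ℝ (hψ.2.of_le le_top)
  have hlip : LocallyLipschitzOn K ψ := (locallyLipschitzOn_of_contMDiffOn hψ.1 hψℝ).mono hKV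
  obtain ⟨C, hC⟩ := exists_lipschitzOnWith_of_isCompact hK hlip
  refine ⟨C, fun y hy z hz => ?_⟩
  rw [← IsRiemannianManifold.out (I := 𝓘(ℝ, ℂ))]
  exact hC hy hz

end IsLocalHolomorphic

end Holomorphic

namespace AdmissibleRiemannianPolyhedron

variable {X : Type*} [TopologicalSpace X] {m : ℕ} {P : AdmissibleRiemannianPolyhedron X m}
  {E : Type*} [NormedAddCommGroup E] [NormedSpace ℂ E]
  {N : Type*} [TopologicalSpace N] [RegularSpace N] [ChartedSpace E N] [IsManifold 𝓘(ℂ, E) ω N]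
  [RiemannianBundle (fun x : N => TangentSpace 𝓘(ℝ, E) x)]
  [IsContinuousRiemannianBundle E (fun x : N => TangentSpace 𝓘(ℝ, E) x)]
  {O : Set X} {φ : X → N} {V : Set N} {ψ : N → ℂ}

theorem IsW12Loc.comp_isLocalHolomorphic (hφ : ContinuousOn φ O) (hφW : P.IsW12Loc E O φ)
    (hψ : IsLocalHolomorphic E V ψ) : P.IsW12Loc ℂ (O ∩ φ ⁻¹' V) (ψ ∘ φ) := by
  refine IsW12LocDist.of_dist_le_on_compacts hφW inter_subset_left fun K hKO hK => ?_
  obtain ⟨C, hC⟩ := hψ.exists_edist_le_riemannianEDist_of_isCompact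
    (hK.image_of_continuousOn (hφ.mono fun p hp => (hKO hp).1))
    (image_subset_iff.2 fun p hp => (hKO hp).2)
  exact ⟨C, fun p hp q hq => hC _ (mem_image_of_mem φ hp) _ (mem_image_of_mem φ hq)⟩

theorem IsPHWC.comp_isLocalHolomorphic (h : P.IsPHWC E O φ) (hψ : IsLocalHolomorphic E V ψ) :
    P.IsPHWC ℂ (O ∩ φ ⁻¹' V) (ψ ∘ φ) := by
  obtain ⟨hφ, hφW, hconf⟩ := h
  refine ⟨hψ.2.continuousOn.comp (hφ.mono inter_subset_left) fun p hp => hp.2,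
    IsW12Loc.comp_isLocalHolomorphic hφ hφW hψ, fun V' W' v w hv hw => ?_⟩
  have hdomain : O ∩ φ ⁻¹' V ∩ (ψ ∘ φ) ⁻¹' (V' ∩ W') =
      O ∩ φ ⁻¹' ((V ∩ ψ ⁻¹' V') ∩ (V ∩ ψ ⁻¹' W')) := by
    rw [← inter_inter_distrib_left, inter_assoc]
    rfl
  rw [hdomain]
  exact hconf _ _ _ _ (hv.comp hψ) (hw.comp hψ)

end AdmissibleRiemannianPolyhedron

theorem proposition3p5_general {X : Type*} [TopologicalSpace X] {m : ℕ}
    (P : AdmissibleRiemannianPolyhedron X m)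
    {E : Type*} [NormedAddCommGroup E] [NormedSpace ℂ E]
    {N : Type*} [TopologicalSpace N] [RegularSpace N] [ChartedSpace E N] [IsManifold 𝓘(ℂ, E) ω N]
    [RiemannianBundle (fun x : N => TangentSpace 𝓘(ℝ, E) x)]
    [IsContinuousRiemannianBundle E (fun x : N => TangentSpace 𝓘(ℝ, E) x)]
    {O : Set X} (hO : IsOpen O) {φ : X → N} (hφ : ContinuousOn φ O) (hφW : P.IsW12Loc E O φ) :
    P.IsPHWC E O φ ↔
      ∀ (V : Set N) (ψ : N → ℂ), IsLocalHolomorphic E V ψ →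
        P.IsPHWC ℂ (O ∩ φ ⁻¹' V) (ψ ∘ φ) := by
  refine ⟨fun h V ψ hψ => h.comp_isLocalHolomorphic hψ, fun h => ⟨hφ, hφW, fun V W v w hv hw => ?_⟩⟩
  have hVW : IsOpen (V ∩ W) := hv.1.inter hw.1
  have hself : ∀ ψ : N → ℂ, IsLocalHolomorphic E (V ∩ W) ψ →
      P.ConformalPair (O ∩ φ ⁻¹' (V ∩ W)) φ ψ ψ := fun ψ hψ => by
    have hid := (h _ ψ hψ).2.2 univ univ id id .id .id
    rw [inter_self, preimage_univ, inter_univ] at hid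
    exact hid
  have hv' := hv.mono hVW inter_subset_left
  have hw' := hw.mono hVW inter_subset_right
  exact .polarize (hφ.isOpen_inter_preimage hO hVW) (hself v hv') (hself w hw')
    (hself _ (hv'.add hw'))

theorem proposition3p5
    {X : Type*} [TopologicalSpace X] {m : ℕ} (P : AdmissibleRiemannianPolyhedron X m)
    {E : Type*} [NormedAddCommGroup E] [NormedSpace ℂ E] [FiniteDimensional ℂ E]
    {N : Type*} [TopologicalSpace N] [T2Space N] [SecondCountableTopology N]
    [ChartedSpace E N] [IsManifold 𝓘(ℂ, E) ω N]
    [RiemannianBundle (fun x : N => TangentSpace 𝓘(ℝ, E) x)]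
    [IsContMDiffRiemannianBundle 𝓘(ℝ, E) ∞ E (fun x : N => TangentSpace 𝓘(ℝ, E) x)]
    (hN : IsHermitianMetric E N)
    (φ : X → N) (hφ : Continuous φ) (hφW : P.IsW12Loc E univ φ) :
    P.IsPHWC E univ φ ↔
      ∀ (V : Set N) (ψ : N → ℂ), IsLocalHolomorphic E V ψ →
        P.IsPHWC ℂ (φ ⁻¹' V) (ψ ∘ φ) := by
  have : LocallyCompactSpace N := Manifold.locallyCompact_of_finiteDimensional 𝓘(ℂ, E)
  have := isContinuousRiemannianBundle_of_isContMDiffRiemannianBundle 𝓘(ℝ, E) ∞ E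
    (fun x : N => TangentSpace 𝓘(ℝ, E) x)
  simpa only [univ_inter] using proposition3p5_general P isOpen_univ hφ.continuousOn hφW
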